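/- Let $G=(V,E)$ be a finite directed graph without self loops and parallel edges, with incidence matrix $\Gamma\in\mathbb{R}^{V\times E}$ ($\gamma_{v,e}=1$ if $e$ enters $v$, $-1$ if $e$ leaves $v$, $0$ otherwise). Consider one of two variants. In the *directed* variant put $D=[0,\infty)$ and let $G$ be strongly connected; in the *undirected* variant put $D=\mathbb{R}$ and let $G$ be connected (ignoring orientations). For every edge $e$ let $F_e:D\to\mathbb{R}$ be strictly convex and differentiable with derivative $f_e$ (one-sided at the boundary of $D$); in the directed variant $F_e$ is also non-negative, non-decreasing and tends to $\infty$. Let $b^0,b\in\mathbb{R}^V$ with $\sum_v b^0_v=\sum_v b_v=0$, and for every $\lambda\ge 0$ let $x(\lambda)$ be the minimum-cost flow for $\lambda$, i.e. the (unique) optimal solution, assumed to exist in the undirected variant, of $$\min \sum_{e\in E}F_e(x_e)\quad\text{s.t.}\quad \Gamma x=b^0+\lambda b,\quad x\in D^E .$$ Fix a vertex $r=v_1$. Let $\pi_v(\lambda)$ be the length of a shortest path from $r$ to $v$ in the graph that contains every $e\in E$ with length $f_e(x_e(\lambda))$ and, for every $e$ with $x_e(\lambda)>0$ (in the undirected variant: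 for every $e$), the reversal of $e$ with length $-f_e(x_e(\lambda))$. The support is $S(\lambda)=\{e=(v,w)\in E: f_e(x_e(\lambda))=\pi_w(\lambda)-\pi_v(\lambda)\}$. Fix $\lambda\ge 0$ such that each $f_e$ is differentiable at $x_e(\lambda)$ (relative to $D$) with $a_e:=f_e'(x_e(\lambda))>0$, and put $A_\lambda=\operatorname{diag}(a_e)_{e\in E}$. For $\alpha\in\mathbb{R}_{>0}^E$ let $L(\alpha)=\Gamma\operatorname{diag}(\mathbb{1}_{e\in S(\lambda)}/\alpha_e)\Gamma^\top$, and for $M\in\mathbb{R}^{V\times V}$ let $\hat M$ be $M$ without the row and column of $r$; if $\hat M$ is invertible, $M^*$ denotes $\hat M^{-1}$ bordered by a zero row and a zero column for $r$. Derivatives of $x$ are taken relative to $[0,\infty)$. (i) **Thomson's principle.** If $x$ is differentiable at $\lambda$, then for every $y\in D^E$ with $\Gamma y=b$ and $y_e=0$ for all $e\notin S(\lambda)$, $$\Big(\tfrac{d}{d\lambda}x(\lambda)\Big)^\top A_\lambda\,\tfrac{d}{d\lambda}x(\lambda)\le y^\top A_\lambda y .$$ If the support is constant on a neighbourhood of $\lambda$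 in $[0,\infty)$, then $x$ is differentiable at $\lambda$, the vector $\tfrac{d}{d\lambda}x(\lambda)$ satisfies $\Gamma\tfrac{d}{d\lambda}x(\lambda)=b$ and vanishes outside $S(\lambda)$, and the inequality holds for all $y\in\mathbb{R}^E$ (of any sign) with $\Gamma y=b$ and $y_e=0$ for $e\notin S(\lambda)$. (ii) **Rayleigh's monotonicity law.** Let $\tilde a\in\mathbb{R}^E$ with $\tilde a_e\ge a_e$ for all $e$, and put $L_\lambda=L(a)$, $\tilde L=L(\tilde a)$. Then $\hat L_\lambda$ and $\hat{\tilde L}$ are invertible and $$b^\top L_\lambda^* b\le b^\top\tilde L^* b .$$ -/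

import Mathlib

namespace ParametricFlow

noncomputable section

open scoped Matrix
open Set

/-- The two variants of the minimum-cost flow problem: in the directed variant flows are
non-negative, in the undirected variant flows are arbitrary real vectors. -/
inductive FlowModel where
  | directed
  | undirected

/-- The set of flow values admitted on an edge. -/
def FlowModel.domain : FlowModel → Set ℝ
  | .directed => Ici 0
  | .undirected => univ

/-- A directed graph with vertex type `V` and edge type `E`, without self loops and without
parallel edges. -/
structure Network (V E : Type*) where
  tail : E → V
  head : E → V
  loopless : ∀ e, tail e ≠ head e
  no_parallel : ∀ e e', tail e = tail e' → head e = head e' → e = e'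

namespace Network

variable {V E : Type*}

/-- Every vertex is reachable from every other vertex along directed edges. -/
def StronglyConnected (N : Network V E) : Prop :=
  ∀ v w, Relation.ReflTransGen (fun p q => ∃ e, N.tail e = p ∧ N.head e = q) v w

/-- Every vertex is reachable from every other vertex if the orientation of the edges is
disregarded. -/
def WeaklyConnected (N : Network V E) : Prop :=
  ∀ v w, Relation.ReflTransGen
    (fun p q => ∃ e, (N.tail e = p ∧ N.head e = q) ∨ (N.head e = p ∧ N.tail e = q)) v w

/-- The connectivity required of the network: strong connectivity for directed flows,
connectivity for undirected flows. -/
def ConnectedFor (N : Network V E) : FlowModel → Prop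
  | .directed => N.StronglyConnected
  | .undirected => N.WeaklyConnected

/-- The incidence matrix: `1` if the edge enters the vertex, `-1` if it leaves the vertex. -/
def incidence [DecidableEq V] (N : Network V E) : Matrix V E ℝ :=
  Matrix.of fun v e => if N.head e = v then 1 else if N.tail e = v then -1 else 0

end Network

/-- The standing assumptions on an edge cost function: it is strictly convex and differentiable
on the set of admissible flow values (one-sidedly at the boundary); in the directed variant it is
moreover non-negative, non-decreasing and tends to infinity. -/
structure IsEdgeCost (m : FlowModel) (F : ℝ → ℝ) : Prop where
  strictConvex : StrictConvexOn ℝ m.domain F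
  differentiable : DifferentiableOn ℝ F m.domain
  nonneg : m = .directed → ∀ t ∈ m.domain, 0 ≤ F t
  monotone : m = .directed → MonotoneOn F m.domain
  tendsto : m = .directed → Filter.Tendsto F Filter.atTop Filter.atTop

/-- The marginal cost `f = F'` (one-sided at the boundary of the domain). -/
def marginal (m : FlowModel) (F : ℝ → ℝ) (t : ℝ) : ℝ := derivWithin F m.domain t

/-- The slope `f' = F''` of the marginal cost (one-sided at the boundary of the domain). -/
def marginalSlope (m : FlowModel) (F : ℝ → ℝ) (t : ℝ) : ℝ :=
  derivWithin (marginal m F) m.domain t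

section Flow

variable {V E : Type*} [Fintype E] [DecidableEq V]

/-- `y` is a feasible flow for the demand vector `d`. -/
def IsFeasible (m : FlowModel) (N : Network V E) (d : V → ℝ) (y : E → ℝ) : Prop :=
  N.incidence *ᵥ y = d ∧ ∀ e, y e ∈ m.domain

/-- `y` is a minimum-cost flow for the demand vector `d`. -/
def IsMinCostFlow (m : FlowModel) (N : Network V E) (F : E → ℝ → ℝ) (d : V → ℝ)
    (y : E → ℝ) : Prop :=
  IsFeasible m N d y ∧ ∀ z, IsFeasible m N d z → ∑ e, F e (y e) ≤ ∑ e, F e (z e)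

end Flow

section Potential

variable {V E : Type*}

/-- The edges that may also be traversed backwards in the residual graph: those carrying positive
flow in the directed variant, all edges in the undirected variant. -/
def usedEdges (y : E → ℝ) : FlowModel → Set E
  | .directed => {e | 0 < y e}
  | .undirected => univ

/-- `IsWalkLength m N F y r v l`: there is a directed walk of length `l` from `r` to `v` in the
residual graph of the flow `y`, in which every edge `e` is a forward arc of length `f_e(y_e)` and
every used edge `e` is moreover a backward arc of length `-f_e(y_e)`. -/
inductive IsWalkLength (m : FlowModel) (N : Network V E) (F : E → ℝ → ℝ) (y : E → ℝ) (r : V) :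
    V → ℝ → Prop
  | nil : IsWalkLength m N F y r r 0
  | forward (e : E) (l : ℝ) : IsWalkLength m N F y r (N.tail e) l →
      IsWalkLength m N F y r (N.head e) (l + marginal m (F e) (y e))
  | backward (e : E) (l : ℝ) : e ∈ usedEdges y m → IsWalkLength m N F y r (N.head e) l →
      IsWalkLength m N F y r (N.tail e) (l - marginal m (F e) (y e))

/-- The shortest-path potential `π` of the flow `y`: `π_v` is the length of a shortest walk from
the root `r` to `v` in the residual graph. For a minimum-cost flow `y` there are no negative
cycles, and this is the length of a shortest path. -/
def potential (m : FlowModel) (N : Network V E) (F : E → ℝ → ℝ) (r : V) (y : E → ℝ) (v : V) : ℝ :=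
  sInf {l | IsWalkLength m N F y r v l}

/-- The support of the flow `y`: the edges `e = (v,w)` with `f_e(y_e) = π_w - π_v`. -/
def support (m : FlowModel) (N : Network V E) (F : E → ℝ → ℝ) (r : V) (y : E → ℝ) : Set E :=
  {e | marginal m (F e) (y e)
    = potential m N F r y (N.head e) - potential m N F r y (N.tail e)}

end Potential

section Laplacian

variable {V E : Type*} [Fintype V] [Fintype E] [DecidableEq V] [DecidableEq E]

/-- The quadratic form `yᵀ diag(a) y`. -/
def energy (a y : E → ℝ) : ℝ := y ⬝ᵥ (Matrix.diagonal a *ᵥ y)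

/-- The Laplacian `Γ C Γᵀ` with `C = diag(c)`, where `c_e = 1 / a_e` for `e ∈ S` and `c_e = 0`
for `e ∉ S`. -/
def laplacian (N : Network V E) (S : Set E) (a : E → ℝ) : Matrix V V ℝ :=
  N.incidence * Matrix.diagonal (S.indicator fun e => 1 / a e) * N.incidenceᵀ

/-- The matrix `M` with the row and the column of the vertex `r` removed. -/
def reduced (r : V) (M : Matrix V V ℝ) : Matrix {v // v ≠ r} {v // v ≠ r} ℝ :=
  M.submatrix Subtype.val Subtype.val

/-- The generalized inverse `M^*`: the inverse of `reduced r M`, bordered by a zero row and a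
zero column for the vertex `r`. It is meant for matrices `M` for which `reduced r M` is
invertible. -/
def groundedInverse (r : V) (M : Matrix V V ℝ) : Matrix V V ℝ :=
  Matrix.of fun v w =>
    if h : v ≠ r ∧ w ≠ r then (reduced r M)⁻¹ ⟨v, h.1⟩ ⟨w, h.2⟩ else 0

end Laplacian

end

end ParametricFlow

namespace ParametricFlow

open scoped Matrix
open Set

/-! ### Incidence matrix: potential differences and unit edge flows -/

section Incidence

variable {V E : Type*} [Fintype V] [Fintype E] [DecidableEq V]

/-! At a minimum-cost flow the first variation along every residual circulation is non-negative.
Reading walks as flows, this bounds residual walk lengths from below; the potential is therefore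
dual feasible and tight on used edges, and edges outside the support carry no flow. Moreover the
support joins every vertex to the root (`IsMinCostFlow.spansFrom_support`), so the grounded
Laplacians on it are invertible.

Thomson's inequality (`energy_deriv_le`) compares `x (l + ε)` with the competitor `x l + ε • y`. The
potential orders the linear parts of the two cost increments, so optimality orders the second-order
parts; divided by `ε ^ 2` these tend to half the energies.

If the support is locally constant, the change of marginal costs is a potential difference on the
support, hence orthogonal to all circulations there, and so is `a * w` for the electrical flow `w`.
Monotonicity of the marginals then forces `x μ - x l = (μ - l) • w + o(μ - l)`; continuity of `x` is
not presupposed. Orthogonality also makes `w` the energy minimizer.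

Rayleigh's law is a completed square for Dirichlet forms on any spanning edge set. -/

omit [Fintype E] in
lemma incidence_transpose_mulVec (N : Network V E) (u : V → ℝ) (e : E) :
    (N.incidenceᵀ *ᵥ u) e = u (N.head e) - u (N.tail e) := by
  have h : ∀ v, N.incidenceᵀ e v * u v
      = (if N.head e = v then u v else 0) - (if N.tail e = v then u v else 0) := by
    intro v
    by_cases h1 : N.head e = v
    · have h2 : N.tail e ≠ v := fun h2 => N.loopless e (h2.trans h1.symm)
      simp [Network.incidence, h1, h2]
    · by_cases h2 : N.tail e = v <;> simp [Network.incidence, h1, h2]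
  simp only [Matrix.mulVec, dotProduct, h, Finset.sum_sub_distrib]
  simp

lemma dotProduct_incidence_mulVec (N : Network V E) (u : V → ℝ) (y : E → ℝ) :
    u ⬝ᵥ (N.incidence *ᵥ y) = ∑ e, (u (N.head e) - u (N.tail e)) * y e := by
  rw [Matrix.dotProduct_mulVec, ← Matrix.mulVec_transpose]
  simp only [dotProduct, incidence_transpose_mulVec]

omit [Fintype V] in
lemma incidence_mulVec_single [DecidableEq E] (N : Network V E) (e : E) :
    N.incidence *ᵥ Pi.single e 1 = Pi.single (N.head e) 1 - Pi.single (N.tail e) 1 := by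
  ext v
  have h := N.loopless e
  rw [Matrix.mulVec_single_one]
  by_cases h1 : N.head e = v
  · have h2 : N.tail e ≠ v := fun h2 => h (h2.trans h1.symm)
    simp [Network.incidence, h1, h2.symm]
  · by_cases h2 : N.tail e = v
    · simp [Network.incidence, h1, h2, Ne.symm h1]
    · simp [Network.incidence, h1, h2, Ne.symm h1, Ne.symm h2]

end Incidence

/-! ### Weighted Laplacians, electrical flows and Rayleigh's law -/

section Laplacian

variable {V E : Type*} [Fintype V] [Fintype E] [DecidableEq V] [DecidableEq E]

lemma energy_eq_sum (a y : E → ℝ) : energy a y = ∑ e, a e * y e ^ 2 := by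
  simp only [energy, dotProduct, Matrix.mulVec_diagonal]
  exact Finset.sum_congr rfl fun e _ => by ring

/-- The electrical flow induced on the edges of `S` by the vertex potential `u`. -/
noncomputable def potentialFlow (N : Network V E) (S : Set E) (a : E → ℝ) (u : V → ℝ) (e : E) : ℝ :=
  S.indicator (fun e => 1 / a e) e * (u (N.head e) - u (N.tail e))

lemma laplacian_mulVec (N : Network V E) (S : Set E) (a : E → ℝ) (u : V → ℝ) :
    laplacian N S a *ᵥ u = N.incidence *ᵥ potentialFlow N S a u := by
  rw [laplacian, ← Matrix.mulVec_mulVec, ← Matrix.mulVec_mulVec]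
  congr 1
  ext e
  rw [Matrix.mulVec_diagonal, incidence_transpose_mulVec, potentialFlow]

lemma dotProduct_laplacian_mulVec (N : Network V E) (S : Set E) (a : E → ℝ) (u w : V → ℝ) :
    u ⬝ᵥ (laplacian N S a *ᵥ w) = ∑ e, S.indicator (fun e => 1 / a e) e *
      ((u (N.head e) - u (N.tail e)) * (w (N.head e) - w (N.tail e))) := by
  rw [laplacian_mulVec, dotProduct_incidence_mulVec]
  exact Finset.sum_congr rfl fun e _ => by rw [potentialFlow]; ring

/-- The extension of a vector on the vertices other than `r` by zero at `r`. -/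
def extendByZero (r : V) (u : {v // v ≠ r} → ℝ) (v : V) : ℝ :=
  if h : v ≠ r then u ⟨v, h⟩ else 0

omit [Fintype V] in
@[simp] lemma extendByZero_self (r : V) (u : {v // v ≠ r} → ℝ) : extendByZero r u r = 0 := by
  simp [extendByZero]

omit [Fintype V] in
@[simp] lemma extendByZero_coe (r : V) (u : {v // v ≠ r} → ℝ) (v : {v // v ≠ r}) :
    extendByZero r u v = u v := by
  simp [extendByZero, v.2]

lemma dotProduct_extendByZero (r : V) (z : V → ℝ) (u : {v // v ≠ r} → ℝ) :
    z ⬝ᵥ extendByZero r u = (fun v : {v // v ≠ r} => z v) ⬝ᵥ u := by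
  simp only [dotProduct]
  rw [Fintype.sum_eq_add_sum_subtype_ne _ r]
  simp

lemma reduced_mulVec (r : V) (M : Matrix V V ℝ) (u : {v // v ≠ r} → ℝ) (v : {v // v ≠ r}) :
    (reduced r M *ᵥ u) v = (M *ᵥ extendByZero r u) v := by
  rw [Matrix.mulVec, Matrix.mulVec, dotProduct_extendByZero]
  rfl

lemma groundedInverse_mulVec (r : V) (M : Matrix V V ℝ) (b : V → ℝ) :
    groundedInverse r M *ᵥ b
      = extendByZero r ((reduced r M)⁻¹ *ᵥ fun v : {v // v ≠ r} => b v) := by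
  ext v
  simp only [Matrix.mulVec, dotProduct]
  rw [Fintype.sum_eq_add_sum_subtype_ne _ r]
  by_cases h : v = r
  · subst h
    simp [groundedInverse]
  · simp only [groundedInverse, extendByZero, Matrix.of_apply, ne_eq, h, not_false_eq_true,
      not_true_eq_false, and_false, dite_false, zero_mul, zero_add, dite_true, true_and]
    refine Finset.sum_congr rfl fun w _ => ?_
    rw [dif_pos w.2]

/-- The edge set `S` connects every vertex to `r`: a function that is constant along the edges of
`S` is constant. -/
def SpansFrom (N : Network V E) (S : Set E) (r : V) : Prop :=
  ∀ u : V → ℝ, (∀ e ∈ S, u (N.head e) = u (N.tail e)) → ∀ v, u v = u r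

/-- A kernel vector, extended by zero, has zero Dirichlet energy. It is thus constant along `S`,
hence everywhere equal to its value `0` at `r`. -/
lemma isUnit_det_reduced_laplacian {N : Network V E} {S : Set E} {r : V} (hS : SpansFrom N S r)
    {a : E → ℝ} (ha : ∀ e, 0 < a e) : IsUnit (reduced r (laplacian N S a)).det := by
  rw [isUnit_iff_ne_zero]
  intro h0
  obtain ⟨u, hu, hLu⟩ := Matrix.exists_mulVec_eq_zero_iff.mpr h0
  have hq : extendByZero r u ⬝ᵥ (laplacian N S a *ᵥ extendByZero r u) = 0 := by
    rw [dotProduct_comm, dotProduct_extendByZero]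
    simp only [← reduced_mulVec, hLu]
    simp
  rw [dotProduct_laplacian_mulVec] at hq
  have hc : ∀ e, 0 ≤ S.indicator (fun e => 1 / a e) e := fun e =>
    Set.indicator_nonneg (fun e _ => (one_div_pos.mpr (ha e)).le) e
  rw [Finset.sum_eq_zero_iff_of_nonneg
    fun e _ => mul_nonneg (hc e) (mul_self_nonneg _)] at hq
  refine hu (funext fun v => ?_)
  have := hS (extendByZero r u) (fun e he => ?_) v
  · simpa using this
  · have h := hq e (Finset.mem_univ e)
    rw [Set.indicator_of_mem he] at h
    have h2 := (mul_eq_zero.mp h).resolve_left (one_div_pos.mpr (ha e)).ne'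
    exact sub_eq_zero.mp (mul_self_eq_zero.mp h2)

/-- Away from `r` this is the inverse property. The equation at `r` follows because both sides have
coordinate sum zero. -/
lemma laplacian_mulVec_groundedInverse_mulVec {N : Network V E} {S : Set E} {r : V} {a : E → ℝ}
    (hdet : IsUnit (reduced r (laplacian N S a)).det) {b : V → ℝ} (hb : ∑ v, b v = 0) :
    laplacian N S a *ᵥ (groundedInverse r (laplacian N S a) *ᵥ b) = b := by
  set z := laplacian N S a *ᵥ (groundedInverse r (laplacian N S a) *ᵥ b) with hz
  have hne : ∀ v : {v // v ≠ r}, z v = b v := by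
    intro v
    rw [hz, groundedInverse_mulVec, ← reduced_mulVec, Matrix.mulVec_mulVec,
      Matrix.mul_nonsing_inv _ hdet, Matrix.one_mulVec]
  have hsum : ∑ v, z v = 0 := by
    have := dotProduct_laplacian_mulVec N S a 1 (groundedInverse r (laplacian N S a) *ᵥ b)
    simpa [dotProduct, hz] using this
  have hr : z r = b r := by
    rw [Fintype.sum_eq_add_sum_subtype_ne _ r] at hsum hb
    rw [Finset.sum_congr rfl fun v _ => hne v] at hsum
    linarith
  ext v
  by_cases h : v = r
  · rw [h, hr]
  · exact hne ⟨v, h⟩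

/-- Write `c`, `c'` for the conductances of `a`, `a'` and `Δ` for differences along edges, and let
`u`, `w` be the two potentials. Since `w` solves the Laplace equation for `a'`, the pairing of `u`
with `b` is also `∑ c' * Δu * Δw`. Hence the difference of the two sides is `∑ ((c - c') * Δu ^ 2 +
c' * (Δu - Δw) ^ 2)`. -/
theorem groundedInverse_monotone {N : Network V E} {S : Set E} {r : V} (hS : SpansFrom N S r)
    {b : V → ℝ} (hb : ∑ v, b v = 0) {a a' : E → ℝ} (ha : ∀ e, 0 < a e) (haa' : ∀ e, a e ≤ a' e) :
    b ⬝ᵥ (groundedInverse r (laplacian N S a) *ᵥ b)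
      ≤ b ⬝ᵥ (groundedInverse r (laplacian N S a') *ᵥ b) := by
  have ha' : ∀ e, 0 < a' e := fun e => (ha e).trans_le (haa' e)
  have hu := laplacian_mulVec_groundedInverse_mulVec
    (isUnit_det_reduced_laplacian hS ha) hb
  have hw := laplacian_mulVec_groundedInverse_mulVec
    (isUnit_det_reduced_laplacian hS ha') hb
  set u := groundedInverse r (laplacian N S a) *ᵥ b
  set w := groundedInverse r (laplacian N S a') *ᵥ b
  have h1 := dotProduct_laplacian_mulVec N S a u u
  have h2 := dotProduct_laplacian_mulVec N S a' u w
  have h3 := dotProduct_laplacian_mulVec N S a' w w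
  rw [hu, dotProduct_comm] at h1
  rw [hw, dotProduct_comm] at h2 h3
  suffices h : 0 ≤ b ⬝ᵥ u - 2 * (b ⬝ᵥ u) + b ⬝ᵥ w by linarith
  nth_rewrite 1 [h1]
  rw [h2, h3, Finset.mul_sum, ← Finset.sum_sub_distrib, ← Finset.sum_add_distrib]
  refine Finset.sum_nonneg fun e _ => ?_
  by_cases he : e ∈ S
  · simp only [Set.indicator_of_mem he]
    have hle : 1 / a' e ≤ 1 / a e := one_div_le_one_div_of_le (ha e) (haa' e)
    have hp : 0 < 1 / a' e := one_div_pos.mpr (ha' e)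
    nlinarith [mul_nonneg (sub_nonneg.mpr hle) (mul_self_nonneg (u (N.head e) - u (N.tail e))),
      mul_nonneg hp.le (mul_self_nonneg (u (N.head e) - u (N.tail e)
        - (w (N.head e) - w (N.tail e))))]
  · simp [Set.indicator_of_notMem he]

/-- The electrical flow on `S` for the demand `b`: the edge weighted flow is orthogonal to all
circulations on `S`. -/
lemma exists_electricalFlow {N : Network V E} {S : Set E} {r : V} (hS : SpansFrom N S r)
    {b : V → ℝ} (hb : ∑ v, b v = 0) {a : E → ℝ} (ha : ∀ e, 0 < a e) :
    ∃ y : E → ℝ, N.incidence *ᵥ y = b ∧ (∀ e, e ∉ S → y e = 0) ∧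
      ∀ c : E → ℝ, N.incidence *ᵥ c = 0 → (∀ e, e ∉ S → c e = 0) →
        ∑ e, a e * y e * c e = 0 := by
  have hu := laplacian_mulVec_groundedInverse_mulVec (isUnit_det_reduced_laplacian hS ha) hb
  set u := groundedInverse r (laplacian N S a) *ᵥ b
  refine ⟨potentialFlow N S a u, by rw [← laplacian_mulVec, hu],
    fun e he => by simp [potentialFlow, he], fun c hc hcS => ?_⟩
  have h := dotProduct_incidence_mulVec N u c
  rw [hc, dotProduct_zero] at h
  rw [h]
  refine Finset.sum_congr rfl fun e _ => ?_
  by_cases he : e ∈ S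
  · have := (ha e).ne'
    simp only [potentialFlow, Set.indicator_of_mem he]
    field_simp
  · simp [hcS e he]

-- Pythagoras: `z - y` is a circulation on `S`, so the cross term vanishes and the energies differ
-- by that of `z - y`.
omit [Fintype V] in
lemma energy_le_of_orthogonal {N : Network V E} {S : Set E} {b : V → ℝ} {a : E → ℝ}
    (ha : ∀ e, 0 < a e) {y z : E → ℝ} (hy : N.incidence *ᵥ y = b) (hyS : ∀ e, e ∉ S → y e = 0)
    (horth : ∀ c : E → ℝ, N.incidence *ᵥ c = 0 → (∀ e, e ∉ S → c e = 0) →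
        ∑ e, a e * y e * c e = 0)
    (hz : N.incidence *ᵥ z = b) (hzS : ∀ e, e ∉ S → z e = 0) : energy a y ≤ energy a z := by
  have h0 := horth (z - y) (by rw [Matrix.mulVec_sub, hy, hz, sub_self])
    (fun e he => by simp [hyS e he, hzS e he])
  rw [energy_eq_sum, energy_eq_sum]
  have h1 : ∑ e, a e * z e ^ 2 - ∑ e, a e * y e ^ 2
      = 2 * ∑ e, a e * y e * (z - y) e + ∑ e, a e * (z e - y e) ^ 2 := by
    rw [Finset.mul_sum, ← Finset.sum_sub_distrib, ← Finset.sum_add_distrib]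
    exact Finset.sum_congr rfl fun e _ => by simp only [Pi.sub_apply]; ring
  have h2 : 0 ≤ ∑ e, a e * (z e - y e) ^ 2 :=
    Finset.sum_nonneg fun e _ => mul_nonneg (ha e).le (sq_nonneg _)
  linarith

end Laplacian

/-! ### Optimality conditions and the shortest-path potential -/

section Optimality

variable {V E : Type*} [Fintype E] [DecidableEq V]
  {m : FlowModel} {N : Network V E} {F : E → ℝ → ℝ} {d : V → ℝ} {y : E → ℝ} {r : V}

lemma eventually_add_mul_mem_domain {t c : ℝ} {m : FlowModel} (ht : t ∈ m.domain)
    (hc : m = .directed → ¬ 0 < t → 0 ≤ c) :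
    ∀ᶠ ε in nhdsWithin (0 : ℝ) (Ioi 0), t + ε * c ∈ m.domain := by
  cases m with
  | undirected => simp [FlowModel.domain]
  | directed =>
    by_cases h : 0 < t
    · have hcont : Filter.Tendsto (fun ε : ℝ => t + ε * c) (nhdsWithin 0 (Ioi 0)) (nhds t) := by
        have : ContinuousAt (fun ε : ℝ => t + ε * c) 0 := by fun_prop
        simpa [ContinuousAt] using this.tendsto.mono_left nhdsWithin_le_nhds
      filter_upwards [hcont.eventually (lt_mem_nhds h)] with ε hε using le_of_lt hε
    · filter_upwards [self_mem_nhdsWithin] with ε hε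
      exact add_nonneg ht (mul_nonneg (le_of_lt hε) (hc rfl h))

/-- First-order optimality: for small `ε > 0` the flow `y + ε • c` is feasible, so the right
derivative of its cost at `0` is non-negative. -/
lemma IsMinCostFlow.sum_marginal_mul_nonneg (hF : ∀ e, IsEdgeCost m (F e))
    (hy : IsMinCostFlow m N F d y) {c : E → ℝ} (hc : N.incidence *ᵥ c = 0)
    (hcu : ∀ e, e ∉ usedEdges y m → 0 ≤ c e) :
    0 ≤ ∑ e, marginal m (F e) (y e) * c e := by
  have hmem : ∀ᶠ ε in nhdsWithin (0 : ℝ) (Ioi 0), ∀ e, y e + ε * c e ∈ m.domain := by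
    rw [Filter.eventually_all]
    refine fun e => eventually_add_mul_mem_domain (hy.1.2 e) fun hm ht => hcu e ?_
    subst hm
    exact ht
  set T : Set ℝ := Ioi 0 ∩ {ε | ∀ e, y e + ε * c e ∈ m.domain} with hT
  have hTn : T ∈ nhdsWithin (0 : ℝ) (Ioi 0) := Filter.inter_mem self_mem_nhdsWithin hmem
  have hderiv : HasDerivWithinAt (fun ε : ℝ => ∑ e, F e (y e + ε * c e))
      (∑ e, marginal m (F e) (y e) * c e) (Ioi 0) 0 := by
    -- The edge costs are differentiable only within the domain, so the chain rule is applied on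
    -- `T`, where the curve stays inside it.
    refine HasDerivWithinAt.mono_of_mem_nhdsWithin (t := T) ?_ hTn
    refine HasDerivWithinAt.fun_sum fun e _ => ?_
    have h1 : HasDerivWithinAt (F e) (marginal m (F e) (y e)) m.domain (y e + 0 * c e) := by
      rw [zero_mul, add_zero]
      exact ((hF e).differentiable _ (hy.1.2 e)).hasDerivWithinAt
    have h2 : HasDerivWithinAt (fun ε : ℝ => y e + ε * c e) (c e) T 0 := by
      simpa using (((hasDerivWithinAt_id (0 : ℝ) T).mul_const (c e)).const_add (y e))
    exact h1.comp (0 : ℝ) h2 fun ε hε => hε.2 e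
  rw [hasDerivWithinAt_iff_tendsto_slope' (by simp)] at hderiv
  refine ge_of_tendsto hderiv ?_
  filter_upwards [hTn] with ε hε
  rw [slope_def_field, sub_zero]
  refine div_nonneg (sub_nonneg.mpr ?_) (le_of_lt hε.1)
  simp only [zero_mul, add_zero]
  refine hy.2 _ ⟨?_, hε.2⟩
  have : (fun e => y e + ε * c e) = y + ε • c := by ext e; simp
  rw [this, Matrix.mulVec_add, Matrix.mulVec_smul, hc, smul_zero, add_zero]
  exact hy.1.1

omit [DecidableEq V] [Fintype E] in
lemma exists_isWalkLength (hN : N.ConnectedFor m) (F : E → ℝ → ℝ) (y : E → ℝ) (r v : V) :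
    ∃ l, IsWalkLength m N F y r v l := by
  cases m with
  | directed =>
    induction hN r v with
    | refl => exact ⟨0, .nil⟩
    | tail _ h ih =>
      obtain ⟨l, hl⟩ := ih
      obtain ⟨e, rfl, rfl⟩ := h
      exact ⟨_, .forward e l hl⟩
  | undirected =>
    induction hN r v with
    | refl => exact ⟨0, .nil⟩
    | tail _ h ih =>
      obtain ⟨l, hl⟩ := ih
      obtain ⟨e, ⟨rfl, rfl⟩ | ⟨rfl, rfl⟩⟩ := h
      · exact ⟨_, .forward e l hl⟩
      · exact ⟨_, .backward e l (mem_univ e) hl⟩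

/-- Counting signed edge traversals turns a walk into a unit flow, so closed walks can be treated as
circulations without decomposing them into cycles. -/
lemma IsWalkLength.exists_flow [DecidableEq E] {v : V} {l : ℝ} (h : IsWalkLength m N F y r v l) :
    ∃ c : E → ℝ, N.incidence *ᵥ c = Pi.single v 1 - Pi.single r 1 ∧
      (∀ e, e ∉ usedEdges y m → 0 ≤ c e) ∧ ∑ e, marginal m (F e) (y e) * c e = l := by
  induction h with
  | nil => exact ⟨0, by simp⟩
  | forward e l _ ih =>
    obtain ⟨c, h1, h2, h3⟩ := ih
    refine ⟨c + Pi.single e 1, ?_, fun e' he' => ?_, ?_⟩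
    · rw [Matrix.mulVec_add, h1, incidence_mulVec_single]
      abel
    · have : (0 : ℝ) ≤ (Pi.single e 1 : E → ℝ) e' := by
        rw [Pi.single_apply]
        split_ifs <;> norm_num
      exact add_nonneg (h2 e' he') this
    · simp [mul_add, Finset.sum_add_distrib, h3, Pi.single_apply]
  | backward e l he _ ih =>
    obtain ⟨c, h1, h2, h3⟩ := ih
    refine ⟨c - Pi.single e 1, ?_, fun e' he' => ?_, ?_⟩
    · rw [Matrix.mulVec_sub, h1, incidence_mulVec_single]
      abel
    · have : e' ≠ e := fun h => he' (h ▸ he)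
      simpa [this] using h2 e' he'
    · simp [mul_sub, Finset.sum_sub_distrib, h3, Pi.single_apply]

/-- Closing a walk with a fixed return walk gives a residual circulation, whose linear cost is
non-negative. This makes the `sInf` in `potential` a genuine infimum. -/
lemma IsMinCostFlow.bddBelow_walkLength (hN : N.ConnectedFor m) (hF : ∀ e, IsEdgeCost m (F e))
    (hy : IsMinCostFlow m N F d y) (r v : V) : BddBelow {l | IsWalkLength m N F y r v l} := by
  classical
  obtain ⟨l₀, h₀⟩ := exists_isWalkLength hN F y v r
  obtain ⟨c₀, h1, h2, h3⟩ := h₀.exists_flow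
  refine ⟨-l₀, fun l hl => ?_⟩
  obtain ⟨c, k1, k2, k3⟩ := IsWalkLength.exists_flow hl
  have := hy.sum_marginal_mul_nonneg hF (c := c + c₀)
    (by rw [Matrix.mulVec_add, k1, h1]; abel)
    (fun e he => add_nonneg (k2 e he) (h2 e he))
  simp only [Pi.add_apply, mul_add, Finset.sum_add_distrib, h3, k3] at this
  linarith

lemma IsMinCostFlow.potential_head_sub_le (hN : N.ConnectedFor m)
    (hF : ∀ e, IsEdgeCost m (F e)) (hy : IsMinCostFlow m N F d y) (r : V) (e : E) :
    potential m N F r y (N.head e) - potential m N F r y (N.tail e) ≤ marginal m (F e) (y e) := by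
  have : potential m N F r y (N.head e) - marginal m (F e) (y e) ≤ potential m N F r y (N.tail e) :=
    le_csInf (exists_isWalkLength hN F y r _) fun l hl => by
      have := csInf_le (hy.bddBelow_walkLength hN hF r _) (IsWalkLength.forward e l hl)
      change potential m N F r y (N.head e) ≤ _ at this
      linarith
  linarith

lemma IsMinCostFlow.mem_support_of_mem_usedEdges (hN : N.ConnectedFor m)
    (hF : ∀ e, IsEdgeCost m (F e)) (hy : IsMinCostFlow m N F d y) (r : V) {e : E}
    (he : e ∈ usedEdges y m) : e ∈ support m N F r y := by
  refine le_antisymm ?_ (hy.potential_head_sub_le hN hF r e)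
  have : potential m N F r y (N.tail e) + marginal m (F e) (y e) ≤ potential m N F r y (N.head e) :=
    le_csInf (exists_isWalkLength hN F y r _) fun l hl => by
      have := csInf_le (hy.bddBelow_walkLength hN hF r _) (IsWalkLength.backward e l he hl)
      change potential m N F r y (N.tail e) ≤ _ at this
      linarith
  linarith

lemma IsMinCostFlow.eq_zero_of_notMem_support (hN : N.ConnectedFor m)
    (hF : ∀ e, IsEdgeCost m (F e)) (hy : IsMinCostFlow m N F d y) {e : E}
    (he : e ∉ support m N F r y) : y e = 0 := by
  have hu : e ∉ usedEdges y m := fun h => he (hy.mem_support_of_mem_usedEdges hN hF r h)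
  have hd := hy.1.2 e
  cases m with
  | directed => exact le_antisymm (not_lt.mp hu) hd
  | undirected => exact absurd (mem_univ e) hu

/-- Shortest walks use only tight edges, hence the support reaches every vertex from the root. -/
lemma IsMinCostFlow.spansFrom_support (hN : N.ConnectedFor m)
    (hF : ∀ e, IsEdgeCost m (F e)) (hy : IsMinCostFlow m N F d y) (r : V) :
    SpansFrom N (support m N F r y) r := by
  intro u hu v
  set p := potential m N F r y with hp
  have hslack : ∀ e, e ∉ support m N F r y →
      0 < marginal m (F e) (y e) - (p (N.head e) - p (N.tail e)) := fun e he =>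
    sub_pos.mpr (lt_of_le_of_ne (hy.potential_head_sub_le hN hF r e) fun h => he h.symm)
  -- The infimum defining the potential is not known to be attained; a uniform gap `δ` on the
  -- finitely many slack edges replaces attainment.
  obtain ⟨δ, hδ, hδe⟩ : ∃ δ > 0, ∀ e, e ∉ support m N F r y →
      δ ≤ marginal m (F e) (y e) - (p (N.head e) - p (N.tail e)) := by
    classical
    have := Filter.eventually_all.mpr fun e : E => show ∀ᶠ δ in nhdsWithin (0 : ℝ) (Ioi 0),
        e ∉ support m N F r y → δ ≤ marginal m (F e) (y e) - (p (N.head e) - p (N.tail e)) by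
      by_cases he : e ∈ support m N F r y
      · simp [he]
      · filter_upwards [nhdsWithin_le_nhds (Iic_mem_nhds (hslack e he))] with δ hδ _ using hδ
    obtain ⟨δ, h1, h2⟩ := (this.and self_mem_nhdsWithin).exists
    exact ⟨δ, h2, h1⟩
  -- As long as a walk stays in the support, `u` keeps its root value; one slack edge makes the walk
  -- at least `δ` longer than the potential, and this excess never shrinks.
  have hwalk : ∀ w l, IsWalkLength m N F y r w l → p w ≤ l ∧ (u w = u r ∨ p w + δ ≤ l) := by
    intro w l h
    refine ⟨csInf_le (hy.bddBelow_walkLength hN hF r w) h, ?_⟩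
    induction h with
    | nil => exact Or.inl rfl
    | forward e l h ih =>
      have hl : p (N.tail e) ≤ l := csInf_le (hy.bddBelow_walkLength hN hF r _) h
      by_cases he : e ∈ support m N F r y
      · have he' : marginal m (F e) (y e) = p (N.head e) - p (N.tail e) := he
        rw [hu e he, he']
        exact ih.imp_right fun h => by linarith
      · right
        linarith [hδe e he]
    | backward e l hue h ih =>
      have he := hy.mem_support_of_mem_usedEdges hN hF r hue
      have he' : marginal m (F e) (y e) = p (N.head e) - p (N.tail e) := he
      rw [← hu e he, he']
      exact ih.imp_right fun h => by linarith
  by_contra hne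
  have : p v + δ ≤ p v :=
    le_csInf (exists_isWalkLength hN F y r v) fun l hl => ((hwalk v l hl).2).resolve_left hne
  linarith

end Optimality

/-! ### One edge: second-order expansion and quantitative monotonicity -/

section EdgeCost

variable {m : FlowModel} {F : ℝ → ℝ}

lemma FlowModel.convex_domain (m : FlowModel) : Convex ℝ m.domain := by
  cases m
  · exact convex_Ici 0
  · exact convex_univ

lemma IsEdgeCost.hasDerivWithinAt (hF : IsEdgeCost m F) {t : ℝ} (ht : t ∈ m.domain) :
    HasDerivWithinAt F (marginal m F t) m.domain t :=
  (hF.differentiable t ht).hasDerivWithinAt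

lemma IsEdgeCost.strictMonoOn_marginal (hF : IsEdgeCost m F) :
    StrictMonoOn (marginal m F) m.domain :=
  hF.strictConvex.strictMonoOn_derivWithin hF.differentiable

/-- Second order Taylor expansion of an edge cost. -/
lemma IsEdgeCost.taylor_isLittleO (hF : IsEdgeCost m F) {X a : ℝ} (hX : X ∈ m.domain)
    (ha : HasDerivWithinAt (marginal m F) a m.domain X) :
    (fun t => F t - F X - marginal m F X * (t - X) - a / 2 * (t - X) ^ 2)
      =o[nhdsWithin X m.domain] fun t => (t - X) ^ 2 := by
  rw [Asymptotics.isLittleO_iff]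
  intro η hη
  have h := Asymptotics.isLittleO_iff.mp ha.isLittleO hη
  rw [Filter.Eventually, Metric.mem_nhdsWithin_iff] at h
  obtain ⟨δ, hδ, hsub⟩ := h
  filter_upwards [inter_mem_nhdsWithin m.domain (Metric.ball_mem_nhds X hδ)] with t ht
  -- The remainder has derivative at most `η * |t - X|` on this convex set containing `X` and `t`,
  -- so the mean value inequality bounds it by `η * |t - X| ^ 2`.
  have hconv : Convex ℝ (Metric.closedBall X |t - X| ∩ m.domain) :=
    (convex_closedBall _ _).inter m.convex_domain
  have hder : ∀ s ∈ Metric.closedBall X |t - X| ∩ m.domain,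
      HasDerivWithinAt (fun t => F t - F X - marginal m F X * (t - X) - a / 2 * (t - X) ^ 2)
        (marginal m F s - marginal m F X - (s - X) * a)
        (Metric.closedBall X |t - X| ∩ m.domain) s := by
    intro s hs
    have h1 := (hF.hasDerivWithinAt hs.2).mono
      (inter_subset_right (s := Metric.closedBall X |t - X|) (t := m.domain))
    have h2 : HasDerivWithinAt (fun t : ℝ => t - X) 1
      (Metric.closedBall X |t - X| ∩ m.domain) s := (hasDerivWithinAt_id s _).sub_const X
    have := ((h1.sub_const (F X)).sub (h2.const_mul (marginal m F X))).sub
      ((h2.pow 2).const_mul (a / 2))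
    refine this.congr_deriv ?_
    simp
    ring
  have hbound : ∀ s ∈ Metric.closedBall X |t - X| ∩ m.domain,
      ‖marginal m F s - marginal m F X - (s - X) * a‖ ≤ η * |t - X| := by
    intro s hs
    have hsX : |s - X| ≤ |t - X| := by simpa [Real.dist_eq] using hs.1
    have htX : |t - X| < δ := by simpa [Real.dist_eq] using ht.2
    have := hsub ⟨by simpa [Real.dist_eq] using hsX.trans_lt htX, hs.2⟩
    simp only [mem_ofPred_eq, smul_eq_mul, Real.norm_eq_abs] at this
    exact this.trans (mul_le_mul_of_nonneg_left hsX hη.le)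
  have := hconv.norm_image_sub_le_of_norm_hasDerivWithin_le hder hbound
    (x := X) (y := t) ⟨by simp, hX⟩ ⟨by simp [Real.dist_eq], ht.1⟩
  simp only [sub_self, mul_zero, sub_zero, ne_eq, OfNat.ofNat_ne_zero, not_false_eq_true,
    zero_pow, Real.norm_eq_abs] at this
  rw [Real.norm_eq_abs, Real.norm_eq_abs, abs_of_nonneg (sq_nonneg (t - X))]
  rwa [mul_assoc, abs_mul_abs_self, ← sq] at this

/-- The second order remainder of an edge cost along a differentiable curve. -/
lemma IsEdgeCost.tendsto_remainder_div_sq (hF : IsEdgeCost m F) {X a : ℝ} (hX : X ∈ m.domain)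
    (ha : HasDerivWithinAt (marginal m F) a m.domain X) {φ : ℝ → ℝ} {c : ℝ} (hφ0 : φ 0 = X)
    (hφ : HasDerivWithinAt φ c (Ioi 0) 0)
    (hφD : ∀ᶠ ε in nhdsWithin (0 : ℝ) (Ioi 0), φ ε ∈ m.domain) :
    Filter.Tendsto (fun ε => (F (φ ε) - F X - marginal m F X * (φ ε - X)) / ε ^ 2)
      (nhdsWithin 0 (Ioi 0)) (nhds (a / 2 * c ^ 2)) := by
  have hlim : Filter.Tendsto φ (nhdsWithin 0 (Ioi 0)) (nhdsWithin X m.domain) := by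
    refine tendsto_nhdsWithin_iff.mpr ⟨?_, hφD⟩
    simpa [ContinuousWithinAt, hφ0] using hφ.continuousWithinAt.tendsto
  have hslope : Filter.Tendsto (fun ε => (φ ε - X) / ε) (nhdsWithin 0 (Ioi 0)) (nhds c) := by
    have := (hasDerivWithinAt_iff_tendsto_slope' (by simp)).mp hφ
    refine this.congr fun ε => ?_
    rw [slope_def_field, hφ0, sub_zero]
  have hO : (fun ε => (φ ε - X) ^ 2) =O[nhdsWithin 0 (Ioi 0)] fun ε : ℝ => ε ^ 2 := by
    refine Asymptotics.IsBigO.pow ?_ 2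
    have := hφ.differentiableWithinAt.isBigO_sub
    simpa [hφ0] using this
  have ho := (((hF.taylor_isLittleO hX ha).comp_tendsto hlim).trans_isBigO hO).tendsto_div_nhds_zero
  have := ho.add ((hslope.pow 2).const_mul (a / 2))
  rw [zero_add] at this
  refine this.congr' ?_
  filter_upwards [self_mem_nhdsWithin] with ε hε
  have : ε ≠ 0 := ne_of_gt hε
  simp only [Function.comp_apply]
  field_simp
  ring

lemma IsEdgeCost.marginal_sub_mul_sub_nonneg (hF : IsEdgeCost m F) {X t : ℝ} (hX : X ∈ m.domain)
    (ht : t ∈ m.domain) : 0 ≤ (marginal m F t - marginal m F X) * (t - X) := by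
  have hmono := hF.strictMonoOn_marginal.monotoneOn
  rcases le_total X t with h | h
  · exact mul_nonneg (sub_nonneg.mpr (hmono hX ht h)) (sub_nonneg.mpr h)
  · exact mul_nonneg_of_nonpos_of_nonpos (sub_nonpos.mpr (hmono ht hX h)) (sub_nonpos.mpr h)

/-- Within `δ` of `X`, continuity bounds the increment by `1`; farther away, `|t - X| / δ ≥ 1` lets
the product dominate, with `K = 1 / δ`. -/
lemma IsEdgeCost.exists_abs_marginal_sub_le (hF : IsEdgeCost m F) {X : ℝ} (hX : X ∈ m.domain)
    (hc : ContinuousWithinAt (marginal m F) m.domain X) :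
    ∃ K, 0 ≤ K ∧ ∀ t ∈ m.domain, |marginal m F t - marginal m F X|
      ≤ 1 + K * ((marginal m F t - marginal m F X) * (t - X)) := by
  obtain ⟨δ, hδ, h⟩ := Metric.continuousWithinAt_iff.mp hc 1 one_pos
  refine ⟨1 / δ, by positivity, fun t ht => ?_⟩
  have hQ := hF.marginal_sub_mul_sub_nonneg hX ht
  rcases lt_or_ge |t - X| δ with h1 | h1
  · have h2 := h ht (by simpa [Real.dist_eq] using h1)
    rw [Real.dist_eq] at h2
    have : 0 ≤ 1 / δ * ((marginal m F t - marginal m F X) * (t - X)) := by positivity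
    linarith
  · rw [← abs_of_nonneg hQ, abs_mul, one_div_mul_eq_div]
    have : |marginal m F t - marginal m F X|
        ≤ |marginal m F t - marginal m F X| * |t - X| / δ := by
      rw [le_div_iff₀ hδ]
      exact mul_le_mul_of_nonneg_left h1 (abs_nonneg _)
    linarith

/-- Monotonicity reduces the bound to `X + δ` and `X - δ`. If one of these leaves the domain, no
admissible `t` lies beyond it and any constant serves. -/
lemma IsEdgeCost.exists_le_marginal_sub_mul_sub (hF : IsEdgeCost m F) {X : ℝ} (hX : X ∈ m.domain)
    {δ : ℝ} (hδ : 0 < δ) :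
    ∃ c > 0, ∀ t ∈ m.domain, δ ≤ |t - X| →
      c ≤ (marginal m F t - marginal m F X) * (t - X) := by
  have hmono := hF.strictMonoOn_marginal
  have hord := m.convex_domain.ordConnected
  have hplus : ∃ c > 0, ∀ t ∈ m.domain, X + δ ≤ t →
      c ≤ (marginal m F t - marginal m F X) * (t - X) := by
    by_cases h : X + δ ∈ m.domain
    · have h0 : 0 < marginal m F (X + δ) - marginal m F X :=
        sub_pos.mpr (hmono hX h (by linarith))
      refine ⟨_, mul_pos h0 hδ, fun t ht hle => ?_⟩
      have := hmono.monotoneOn h ht hle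
      exact mul_le_mul (by linarith) (by linarith) hδ.le (by linarith)
    · exact ⟨1, one_pos, fun t ht hle =>
        absurd (hord.out hX ht ⟨by linarith, hle⟩) h⟩
  have hminus : ∃ c > 0, ∀ t ∈ m.domain, t ≤ X - δ →
      c ≤ (marginal m F t - marginal m F X) * (t - X) := by
    by_cases h : X - δ ∈ m.domain
    · have h0 : 0 < marginal m F X - marginal m F (X - δ) :=
        sub_pos.mpr (hmono h hX (by linarith))
      refine ⟨_, mul_pos h0 hδ, fun t ht hle => ?_⟩
      have := hmono.monotoneOn ht h hle
      rw [← neg_mul_neg (marginal m F t - _)]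
      exact mul_le_mul (by linarith) (by linarith) hδ.le (by linarith)
    · exact ⟨1, one_pos, fun t ht hle =>
        absurd (hord.out ht hX ⟨hle, by linarith⟩) h⟩
  obtain ⟨c₁, hc₁, h₁⟩ := hplus
  obtain ⟨c₂, hc₂, h₂⟩ := hminus
  refine ⟨min c₁ c₂, lt_min hc₁ hc₂, fun t ht hle => ?_⟩
  rcases le_abs.mp hle with h | h
  · exact (min_le_left _ _).trans (h₁ t ht (by linarith))
  · exact (min_le_right _ _).trans (h₂ t ht (by linarith))

end EdgeCost

/-! ### Convergence and differentiability from orthogonality relations -/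

section Perturbation

variable {E ι : Type*} [Fintype E] {m : FlowModel} {F : E → ℝ → ℝ} {X w : E → ℝ}
  {𝓕 : Filter ι} {z : ι → E → ℝ} {ε : ι → ℝ}

/-- Let `Q` be the sum of the products of marginal increment and flow increment. The relation gives
`Q ≤ |ε| * (W + C * Q)`; once `|ε| * C < 1 / 2`, the last term is absorbed, so `Q` tends to zero,
and each edge flow converges by strict monotonicity. -/
lemma tendsto_of_sum_marginal_sub_mul_eq_zero (hF : ∀ e, IsEdgeCost m (F e))
    (hX : ∀ e, X e ∈ m.domain)
    (hc : ∀ e, ContinuousWithinAt (marginal m (F e)) m.domain (X e))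
    (hε : Filter.Tendsto ε 𝓕 (nhds 0))
    (hz : ∀ᶠ i in 𝓕, (∀ e, z i e ∈ m.domain) ∧
      ∑ e, (marginal m (F e) (z i e) - marginal m (F e) (X e)) * (z i e - X e - ε i * w e) = 0)
    (e : E) : Filter.Tendsto (fun i => z i e) 𝓕 (nhdsWithin (X e) m.domain) := by
  choose K hK0 hK using fun e => (hF e).exists_abs_marginal_sub_le (hX e) (hc e)
  set C := ∑ e, |w e| * K e with hC
  set W := ∑ e, |w e| with hW
  have hC0 : 0 ≤ C := Finset.sum_nonneg fun e _ => mul_nonneg (abs_nonneg _) (hK0 e)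
  have habs : Filter.Tendsto (fun i => |ε i|) 𝓕 (nhds 0) := by simpa using hε.abs
  have hQ : ∀ᶠ i in 𝓕, (marginal m (F e) (z i e) - marginal m (F e) (X e)) * (z i e - X e)
      ≤ 2 * (|ε i| * W) := by
    have hsmall : ∀ᶠ i in 𝓕, |ε i| * C < 1 / 2 := by
      have : Filter.Tendsto (fun i => |ε i| * C) 𝓕 (nhds 0) := by simpa using habs.mul_const C
      exact this.eventually (gt_mem_nhds (by norm_num))
    filter_upwards [hz, hsmall] with i hi hs
    set q : E → ℝ := fun e =>
      (marginal m (F e) (z i e) - marginal m (F e) (X e)) * (z i e - X e) with hq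
    have hq0 : ∀ e, 0 ≤ q e := fun e => (hF e).marginal_sub_mul_sub_nonneg (hX e) (hi.1 e)
    have hle : ∀ e, q e ≤ ∑ e, q e := fun e =>
      Finset.single_le_sum (fun e _ => hq0 e) (Finset.mem_univ e)
    have hsum : ∑ e, q e = ∑ e, ε i * w e *
        (marginal m (F e) (z i e) - marginal m (F e) (X e)) := by
      rw [← sub_eq_zero, ← Finset.sum_sub_distrib, ← hi.2]
      exact Finset.sum_congr rfl fun e _ => by simp only [hq]; ring
    have hbound : ∑ e, q e ≤ |ε i| * W + |ε i| * C * ∑ e, q e := by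
      calc ∑ e, q e ≤ ∑ e, |ε i| * (|w e| + |w e| * K e * ∑ e, q e) := by
            rw [hsum]
            refine Finset.sum_le_sum fun e _ => ?_
            rw [← hsum]
            refine (le_abs_self _).trans ?_
            rw [abs_mul, abs_mul, mul_assoc]
            refine mul_le_mul_of_nonneg_left ?_ (abs_nonneg _)
            have h1 := hK e _ (hi.1 e)
            have h2 : K e * q e ≤ K e * ∑ e, q e := mul_le_mul_of_nonneg_left (hle e) (hK0 e)
            have h3 := mul_le_mul_of_nonneg_left (h1.trans (add_le_add_right h2 1))
              (abs_nonneg (w e))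
            linarith
        _ = _ := by
            rw [← Finset.mul_sum, Finset.sum_add_distrib, ← Finset.sum_mul]
            ring
    have h0 : 0 ≤ ∑ e, q e := Finset.sum_nonneg fun e _ => hq0 e
    have := mul_le_mul_of_nonneg_right hs.le h0
    have := hle e
    change q e ≤ _
    linarith
  refine tendsto_nhdsWithin_iff.mpr ⟨?_, hz.mono fun i hi => hi.1 e⟩
  rw [Metric.tendsto_nhds]
  intro δ hδ
  obtain ⟨c, hc0, hcb⟩ := (hF e).exists_le_marginal_sub_mul_sub (hX e) hδ
  have hlim : Filter.Tendsto (fun i => 2 * (|ε i| * W)) 𝓕 (nhds 0) := by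
    simpa using (habs.mul_const W).const_mul 2
  filter_upwards [hz, hQ, hlim.eventually (gt_mem_nhds hc0)] with i hi h1 h2
  rw [Real.dist_eq]
  by_contra hcon
  linarith [hcb _ (hi.1 e) (not_lt.mp hcon)]

/-- With `u = z - X - ε * w` and `ρ` the linearization error of the marginal, subtracting `ε` times
the second relation from the first gives `∑ (a * u ^ 2 + ρ * u) = 0`. Since `ρ` is small relative to
`z - X = u + ε * w`, the quadratic term forces `u = o(ε)`. -/
lemma isLittleO_of_sum_marginal_sub_mul_eq_zero (hF : ∀ e, IsEdgeCost m (F e))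
    (hX : ∀ e, X e ∈ m.domain) {a : E → ℝ} (hpos : ∀ e, 0 < a e)
    (ha : ∀ e, HasDerivWithinAt (marginal m (F e)) (a e) m.domain (X e))
    (hε : Filter.Tendsto ε 𝓕 (nhds 0))
    (hz : ∀ᶠ i in 𝓕, (∀ e, z i e ∈ m.domain) ∧
      ∑ e, (marginal m (F e) (z i e) - marginal m (F e) (X e)) * (z i e - X e - ε i * w e) = 0)
    (hw : ∀ᶠ i in 𝓕, ∑ e, a e * w e * (z i e - X e - ε i * w e) = 0)
    (e : E) : (fun i => z i e - X e - ε i * w e) =o[𝓕] ε := by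
  obtain ⟨α, hα, hαa⟩ : ∃ α > 0, ∀ e, α ≤ a e := by
    have := Filter.eventually_all.mpr fun e : E =>
      (nhdsWithin_le_nhds (s := Ioi (0 : ℝ))) (Iic_mem_nhds (hpos e))
    obtain ⟨α, h1, h2⟩ := (this.and self_mem_nhdsWithin).exists
    exact ⟨α, h2, h1⟩
  set W := ∑ e, w e ^ 2 with hW
  have hW0 : 0 ≤ W := Finset.sum_nonneg fun e _ => sq_nonneg _
  rw [Asymptotics.isLittleO_iff]
  intro κ hκ
  -- The first bound absorbs `η * u ^ 2` into `α * u ^ 2`. The second yields `4 * η ^ 2 * W ≤ (κ *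
  -- α) ^ 2`; the `1 + W` avoids dividing by zero when `W = 0`.
  obtain ⟨η, hη, hηα, hηκ⟩ : ∃ η > 0, η ≤ α / 2 ∧ η * (2 * (1 + W)) ≤ κ * α := by
    refine ⟨min (α / 2) (κ * α / (2 * (1 + W))), by positivity, min_le_left _ _, ?_⟩
    rw [← le_div_iff₀ (by positivity)]
    exact min_le_right _ _
  have hρ : ∀ᶠ i in 𝓕, ∀ e, |marginal m (F e) (z i e) - marginal m (F e) (X e)
      - (z i e - X e) * a e| ≤ η * |z i e - X e| := by
    rw [Filter.eventually_all]
    intro e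
    have := tendsto_of_sum_marginal_sub_mul_eq_zero hF hX
      (fun e => (ha e).continuousWithinAt) hε hz e
    simpa using this.eventually (Asymptotics.isLittleO_iff.mp (ha e).isLittleO hη)
  filter_upwards [hz, hw, hρ] with i hi hwi hρi
  set u : E → ℝ := fun e => z i e - X e - ε i * w e with hu
  have hterm : ∀ e, α / 4 * u e ^ 2 - η ^ 2 / α * ε i ^ 2 * w e ^ 2 ≤
      a e * u e ^ 2 + (marginal m (F e) (z i e) - marginal m (F e) (X e)
        - (z i e - X e) * a e) * u e := by
    intro e
    have h1 : -(η * |z i e - X e| * |u e|) ≤ (marginal m (F e) (z i e) - marginal m (F e) (X e)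
        - (z i e - X e) * a e) * u e := by
      have := neg_abs_le ((marginal m (F e) (z i e) - marginal m (F e) (X e)
        - (z i e - X e) * a e) * u e)
      rw [abs_mul] at this
      have := mul_le_mul_of_nonneg_right (hρi e) (abs_nonneg (u e))
      linarith
    have h2 : |z i e - X e| ≤ |u e| + |ε i * w e| := by
      have : z i e - X e = u e + ε i * w e := by simp only [hu]; ring
      rw [this]
      exact abs_add_le _ _
    have h3 : η * |z i e - X e| * |u e| ≤ η * u e ^ 2 + η * (|ε i * w e| * |u e|) := by
      have := mul_le_mul_of_nonneg_right (mul_le_mul_of_nonneg_left h2 hη.le) (abs_nonneg (u e))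
      rw [← sq_abs (u e)]
      linarith
    have h4 : η * (|ε i * w e| * |u e|) ≤ α / 4 * u e ^ 2 + η ^ 2 / α * ε i ^ 2 * w e ^ 2 := by
      -- Young's inequality for the mixed term, leaving `α / 4` of the quadratic term.
      have h5 : 0 ≤ (α / 2 * |u e| - η * |ε i * w e|) ^ 2 / α := by positivity
      have h6 : (α / 2 * |u e| - η * |ε i * w e|) ^ 2 / α = α / 4 * |u e| ^ 2
          - η * (|ε i * w e| * |u e|) + η ^ 2 / α * |ε i * w e| ^ 2 := by
        field_simp
        ring
      rw [h6, sq_abs, sq_abs] at h5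
      linarith
    have h7 : η * u e ^ 2 ≤ α / 2 * u e ^ 2 := mul_le_mul_of_nonneg_right hηα (sq_nonneg _)
    have h8 : α * u e ^ 2 ≤ a e * u e ^ 2 := mul_le_mul_of_nonneg_right (hαa e) (sq_nonneg _)
    linarith
  have hzero : ∑ e, (a e * u e ^ 2 + (marginal m (F e) (z i e) - marginal m (F e) (X e)
        - (z i e - X e) * a e) * u e) = 0 := by
    have : ∑ e, (a e * u e ^ 2 + (marginal m (F e) (z i e) - marginal m (F e) (X e)
        - (z i e - X e) * a e) * u e)
        = ∑ e, (marginal m (F e) (z i e) - marginal m (F e) (X e)) * u e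
          - ε i * ∑ e, a e * w e * u e := by
      rw [Finset.mul_sum, ← Finset.sum_sub_distrib]
      exact Finset.sum_congr rfl fun e _ => by simp only [hu]; ring
    rw [this, hi.2, hwi, mul_zero, sub_zero]
  have hsum := Finset.sum_le_sum fun e (_ : e ∈ Finset.univ) => hterm e
  rw [hzero, Finset.sum_sub_distrib, ← Finset.mul_sum, ← Finset.mul_sum, ← hW] at hsum
  have hsingle : u e ^ 2 ≤ ∑ e, u e ^ 2 :=
    Finset.single_le_sum (f := fun e => u e ^ 2) (fun e _ => sq_nonneg _) (Finset.mem_univ e)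
  have hfin : α ^ 2 * u e ^ 2 ≤ 4 * η ^ 2 * W * ε i ^ 2 := by
    have h1 := mul_le_mul_of_nonneg_left hsingle (by positivity : 0 ≤ α / 4)
    have h2 : α / 4 * u e ^ 2 ≤ η ^ 2 / α * ε i ^ 2 * W := by linarith
    have h3 := mul_le_mul_of_nonneg_left h2 (by positivity : 0 ≤ 4 * α)
    have h4 : 4 * α * (η ^ 2 / α * ε i ^ 2 * W) = 4 * η ^ 2 * W * ε i ^ 2 := by field_simp
    linarith
  have hWle : 4 * η ^ 2 * W ≤ (κ * α) ^ 2 := by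
    have h1 : (η * (2 * (1 + W))) ^ 2 ≤ (κ * α) ^ 2 := pow_le_pow_left₀ (by positivity) hηκ 2
    have h2 : 4 * η ^ 2 * W ≤ (η * (2 * (1 + W))) ^ 2 := by
      nlinarith [mul_nonneg (sq_nonneg η) hW0, mul_nonneg (sq_nonneg η) (sq_nonneg W),
        sq_nonneg η]
    linarith
  have hsq : u e ^ 2 ≤ (κ * ε i) ^ 2 := by
    have h1 := mul_le_mul_of_nonneg_right hWle (sq_nonneg (ε i))
    have h2 : α ^ 2 * u e ^ 2 ≤ α ^ 2 * (κ * ε i) ^ 2 := by linarith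
    exact le_of_mul_le_mul_left h2 (by positivity)
  have := sq_le_sq.mp hsq
  rwa [abs_mul, abs_of_pos hκ] at this

end Perturbation

/-! ### Derivative of the parametric minimum-cost flow -/

section Parametric

variable {V E : Type*} [Fintype V] [Fintype E] [DecidableEq V] [DecidableEq E]
  {m : FlowModel} {N : Network V E} {F : E → ℝ → ℝ} {b₀ b : V → ℝ} {r : V} {x : ℝ → E → ℝ}
  {l : ℝ} {a : E → ℝ}

/-- Thomson's principle: the energy of the derivative of a parametric minimum-cost flow is minimal
among the feasible flows on the support. -/
theorem energy_deriv_le (hN : N.ConnectedFor m) (hF : ∀ e, IsEdgeCost m (F e))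
    (hx : ∀ μ : ℝ, 0 ≤ μ → IsMinCostFlow m N F (b₀ + μ • b) (x μ)) (hl : 0 ≤ l)
    (ha : ∀ e, HasDerivWithinAt (marginal m (F e)) (a e) m.domain (x l e))
    {x' : E → ℝ} (hx' : HasDerivWithinAt x x' (Ici 0) l) {y : E → ℝ} (hy : IsFeasible m N b y)
    (hyS : ∀ e, e ∉ support m N F r (x l) → y e = 0) : energy a x' ≤ energy a y := by
  have hX := (hx l hl).1.2
  have hyD : ∀ ε : ℝ, 0 < ε → ∀ e, x l e + ε * y e ∈ m.domain := by
    intro ε hε e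
    have h1 := hX e
    have h2 := hy.2 e
    cases m with
    | directed => exact add_nonneg h1 (mul_nonneg hε.le h2)
    | undirected => exact mem_univ _
  have hφ : ∀ e, HasDerivWithinAt (fun ε => x (l + ε) e) (x' e) (Ioi 0) 0 := by
    intro e
    have h1 : HasDerivWithinAt (fun μ => x μ e) (x' e) (Ici 0) (l + 0) := by
      rw [add_zero]
      exact hasDerivWithinAt_pi.mp hx' e
    have h2 : HasDerivWithinAt (fun ε : ℝ => l + ε) 1 (Ioi 0) 0 :=
      (hasDerivWithinAt_id 0 _).const_add l
    have := h1.comp (0 : ℝ) h2 fun ε (hε : 0 < ε) => add_nonneg hl hε.le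
    rwa [mul_one] at this
  have hψ : ∀ e, HasDerivWithinAt (fun ε => x l e + ε * y e) (y e) (Ioi 0) 0 := fun e => by
    simpa using ((hasDerivWithinAt_id (0 : ℝ) (Ioi 0)).mul_const (y e)).const_add (x l e)
  have hlim₁ := tendsto_finsetSum (Finset.univ : Finset E) fun e _ =>
    (hF e).tendsto_remainder_div_sq (hX e) (ha e) (by simp) (hφ e)
      (eventually_mem_of_tendsto_nhdsWithin Filter.tendsto_id |>.mono fun ε (hε : 0 < ε) =>
        (hx (l + ε) (by linarith)).1.2 e)
  have hlim₂ := tendsto_finsetSum (Finset.univ : Finset E) fun e _ =>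
    (hF e).tendsto_remainder_div_sq (hX e) (ha e) (by simp) (hψ e)
      (eventually_mem_of_tendsto_nhdsWithin Filter.tendsto_id |>.mono fun ε (hε : 0 < ε) =>
        hyD ε hε e)
  have hle := le_of_tendsto_of_tendsto hlim₁ hlim₂ ?_
  · rw [energy_eq_sum, energy_eq_sum]
    have h : ∀ c : E → ℝ, ∑ e, a e / 2 * c e ^ 2 = (∑ e, a e * c e ^ 2) / 2 := fun c => by
      rw [Finset.sum_div]
      exact Finset.sum_congr rfl fun e _ => by ring
    rw [h, h] at hle
    linarith
  filter_upwards [self_mem_nhdsWithin] with ε hε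
  have hε : 0 < ε := hε
  rw [← Finset.sum_div, ← Finset.sum_div]
  refine div_le_div_of_nonneg_right ?_ (sq_nonneg ε)
  have hxε := hx (l + ε) (by linarith)
  have hopt := hxε.2 (x l + ε • y) ⟨by
    rw [Matrix.mulVec_add, Matrix.mulVec_smul, (hx l hl).1.1, hy.1, add_smul, add_assoc],
    fun e => hyD ε hε e⟩
  simp only [Pi.add_apply, Pi.smul_apply, smul_eq_mul] at hopt
  set p := potential m N F r (x l) with hp
  -- Both directions ship `ε • b`, so their potential costs agree. Marginal costs equal potential
  -- differences on the support, which carries `y`; outside it they are larger, while the flow can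
  -- only grow from zero.
  have hlin : ∑ e, marginal m (F e) (x l e) * (ε * y e)
      ≤ ∑ e, marginal m (F e) (x l e) * (x (l + ε) e - x l e) := by
    have h1 : ∑ e, marginal m (F e) (x l e) * (ε * y e) = ε * (p ⬝ᵥ b) := by
      rw [← hy.1, dotProduct_incidence_mulVec, Finset.mul_sum]
      refine Finset.sum_congr rfl fun e _ => ?_
      by_cases he : e ∈ support m N F r (x l)
      · rw [show marginal m (F e) (x l e) = p (N.head e) - p (N.tail e) from he]
        ring
      · simp [hyS e he]
    have h2 : ε * (p ⬝ᵥ b)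
        = ∑ e, (p (N.head e) - p (N.tail e)) * (x (l + ε) e - x l e) := by
      rw [← smul_eq_mul, ← dotProduct_smul]
      have : ε • b = N.incidence *ᵥ (x (l + ε) - x l) := by
        rw [Matrix.mulVec_sub, hxε.1.1, (hx l hl).1.1, add_smul]
        abel
      rw [this, dotProduct_incidence_mulVec]
      rfl
    rw [h1, h2]
    refine Finset.sum_le_sum fun e _ => ?_
    by_cases he : e ∈ support m N F r (x l)
    · rw [show marginal m (F e) (x l e) = p (N.head e) - p (N.tail e) from he]
    · have hu : e ∉ usedEdges (x l) m :=
        fun h => he ((hx l hl).mem_support_of_mem_usedEdges hN hF r h)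
      have h0 := (hx l hl).eq_zero_of_notMem_support hN hF he
      refine mul_le_mul_of_nonneg_right ((hx l hl).potential_head_sub_le hN hF r e) ?_
      rw [h0, sub_zero]
      have := hxε.1.2 e
      cases m with
      | directed => exact this
      | undirected => exact absurd (mem_univ e) hu
  simp only [Finset.sum_sub_distrib, add_sub_cancel_left]
  linarith

omit [DecidableEq E] in
/-- While the support is constant, the derivative of a parametric minimum-cost flow is the
electrical flow on the support. -/
theorem hasDerivWithinAt_of_support_eventually_eq (hN : N.ConnectedFor m)
    (hF : ∀ e, IsEdgeCost m (F e))
    (hx : ∀ μ : ℝ, 0 ≤ μ → IsMinCostFlow m N F (b₀ + μ • b) (x μ)) (hl : 0 ≤ l)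
    (ha : ∀ e, HasDerivWithinAt (marginal m (F e)) (a e) m.domain (x l e))
    (hpos : ∀ e, 0 < a e)
    (hS : ∀ᶠ μ in nhdsWithin l (Ici 0), support m N F r (x μ) = support m N F r (x l))
    {w : E → ℝ} (hw : N.incidence *ᵥ w = b) (hwS : ∀ e, e ∉ support m N F r (x l) → w e = 0)
    (horth : ∀ c : E → ℝ, N.incidence *ᵥ c = 0 → (∀ e, e ∉ support m N F r (x l) → c e = 0) →
        ∑ e, a e * w e * c e = 0) :
    HasDerivWithinAt x w (Ici 0) l := by
  have hcirc : ∀ᶠ μ in nhdsWithin l (Ici 0), 0 ≤ μ ∧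
      support m N F r (x μ) = support m N F r (x l) ∧
      N.incidence *ᵥ (x μ - x l - (μ - l) • w) = 0 ∧
      ∀ e, e ∉ support m N F r (x l) → (x μ - x l - (μ - l) • w) e = 0 := by
    filter_upwards [hS, self_mem_nhdsWithin] with μ hμ hμ0
    refine ⟨hμ0, hμ, ?_, fun e he => ?_⟩
    · rw [Matrix.mulVec_sub, Matrix.mulVec_sub, Matrix.mulVec_smul, (hx μ hμ0).1.1,
        (hx l hl).1.1, hw, sub_smul]
      abel
    · simp [hwS e he, (hx l hl).eq_zero_of_notMem_support hN hF he,
        (hx μ hμ0).eq_zero_of_notMem_support hN hF (hμ ▸ he)]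
  rw [hasDerivWithinAt_pi]
  intro e
  refine HasDerivWithinAt.of_isLittleO ?_
  refine isLittleO_of_sum_marginal_sub_mul_eq_zero (m := m) (F := F) (X := x l) (w := w)
    (z := x) (ε := fun μ => μ - l) hF (hx l hl).1.2 hpos ha ?_ ?_ ?_ e
  · have : Filter.Tendsto (fun μ : ℝ => μ - l) (nhds l) (nhds (l - l)) :=
      Filter.tendsto_id.sub_const l
    rw [sub_self] at this
    exact this.mono_left nhdsWithin_le_nhds
  · filter_upwards [hcirc] with μ ⟨hμ0, hμ, hc, hcS⟩
    refine ⟨(hx μ hμ0).1.2, ?_⟩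
    -- On the common support the marginal increment is the edge difference of the change in
    -- potential, and such differences are orthogonal to circulations.
    have h := dotProduct_incidence_mulVec N
      (potential m N F r (x μ) - potential m N F r (x l)) (x μ - x l - (μ - l) • w)
    rw [hc, dotProduct_zero] at h
    rw [h]
    refine Finset.sum_congr rfl fun e _ => ?_
    by_cases he : e ∈ support m N F r (x l)
    · have h1 : marginal m (F e) (x l e) = _ := he
      have h2 : marginal m (F e) (x μ e) = _ := (hμ ▸ he : e ∈ support m N F r (x μ))
      rw [h1, h2]
      simp only [Pi.sub_apply, Pi.smul_apply, smul_eq_mul]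
      ring
    · have h0 := hcS e he
      rw [h0, mul_zero]
      simp only [Pi.sub_apply, Pi.smul_apply, smul_eq_mul] at h0
      rw [h0, mul_zero]
  · filter_upwards [hcirc] with μ ⟨_, _, hc, hcS⟩ using horth _ hc hcS

end Parametric

end ParametricFlow

theorem mainTheorem3 {V E : Type*} [Fintype V] [Fintype E] [DecidableEq V] [DecidableEq E]
    (m : ParametricFlow.FlowModel) (N : ParametricFlow.Network V E) (hN : N.ConnectedFor m)
    (F : E → ℝ → ℝ) (hF : ∀ e, ParametricFlow.IsEdgeCost m (F e))
    (b₀ b : V → ℝ) (hb₀ : ∑ v, b₀ v = 0) (hb : ∑ v, b v = 0) (r : V)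
    (x : ℝ → E → ℝ)
    (hx : ∀ μ : ℝ, 0 ≤ μ → ParametricFlow.IsMinCostFlow m N F (b₀ + μ • b) (x μ))
    (l : ℝ) (hl : 0 ≤ l)
    (hdiff : ∀ e, DifferentiableWithinAt ℝ (ParametricFlow.marginal m (F e)) m.domain (x l e))
    (a : E → ℝ) (ha : ∀ e, a e = ParametricFlow.marginalSlope m (F e) (x l e))
    (hpos : ∀ e, 0 < a e)
    (S : ℝ → Set E) (hS : ∀ μ, S μ = ParametricFlow.support m N F r (x μ)) :
    -- Thomson's principle, at every parameter at which the minimum-cost flow is differentiable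
    (∀ x' : E → ℝ, HasDerivWithinAt x x' (Set.Ici 0) l →
      ∀ y : E → ℝ, ParametricFlow.IsFeasible m N b y → (∀ e, e ∉ S l → y e = 0) →
        ParametricFlow.energy a x' ≤ ParametricFlow.energy a y) ∧
    -- if the support is constant near the parameter, the derivative exists and is a minimizer
    -- among all flows on the support, irrespective of their signs
    ((∀ᶠ μ in nhdsWithin l (Set.Ici 0), S μ = S l) →
      ∃ x' : E → ℝ, HasDerivWithinAt x x' (Set.Ici 0) l ∧
        Matrix.mulVec N.incidence x' = b ∧ (∀ e, e ∉ S l → x' e = 0) ∧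
        ∀ y : E → ℝ, Matrix.mulVec N.incidence y = b → (∀ e, e ∉ S l → y e = 0) →
          ParametricFlow.energy a x' ≤ ParametricFlow.energy a y) ∧
    -- Rayleigh's monotonicity law
    (∀ a' : E → ℝ, (∀ e, a e ≤ a' e) →
      IsUnit (ParametricFlow.reduced r (ParametricFlow.laplacian N (S l) a)).det ∧
      IsUnit (ParametricFlow.reduced r (ParametricFlow.laplacian N (S l) a')).det ∧
      b ⬝ᵥ Matrix.mulVec
          (ParametricFlow.groundedInverse r (ParametricFlow.laplacian N (S l) a)) b
        ≤ b ⬝ᵥ Matrix.mulVec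
          (ParametricFlow.groundedInverse r (ParametricFlow.laplacian N (S l) a')) b) := by
  have ha' : ∀ e, HasDerivWithinAt (ParametricFlow.marginal m (F e)) (a e) m.domain (x l e) :=
    fun e => by
      rw [ha e]
      exact (hdiff e).hasDerivWithinAt
  have hspan := (hx l hl).spansFrom_support hN hF r
  refine ⟨fun x' hx' y hy hyS => ?_, fun hconst => ?_, fun a' haa' => ?_⟩
  · rw [hS l] at hyS
    exact ParametricFlow.energy_deriv_le hN hF hx hl ha' hx' hy hyS
  · simp only [hS] at hconst ⊢
    obtain ⟨w, hw, hwS, horth⟩ := ParametricFlow.exists_electricalFlow hspan hb hpos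
    exact ⟨w, ParametricFlow.hasDerivWithinAt_of_support_eventually_eq hN hF hx hl ha' hpos hconst
      hw hwS horth, hw, hwS, fun y hy hyS =>
        ParametricFlow.energy_le_of_orthogonal hpos hw hwS horth hy hyS⟩
  · rw [hS l]
    exact ⟨ParametricFlow.isUnit_det_reduced_laplacian hspan hpos,
      ParametricFlow.isUnit_det_reduced_laplacian hspan fun e => (hpos e).trans_le (haa' e),
      ParametricFlow.groundedInverse_monotone hspan hb hpos haa'⟩
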